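/- Let $K$ be a field of characteristic $0$ and let $A_1$ be the first Weyl algebra over $K$, i.e. the associative unital $K$-algebra generated by $p,q$ subject to the relation $[p,q]=pq-qp=1$. For $i\in\mathbb{Z}$ let $D_i=\{u\in A_1 : [pq,u]=iu\}$ be the $i$-eigenspace of $\mathrm{ad}(pq)$, and put $D_{\ge 0}=\bigoplus_{i\ge 0}D_i$ and $D_{\le 0}=\bigoplus_{i\le 0}D_i$. Let $z,w\in A_1$ satisfy $[z,w]=1$. Then: (1) If there is a $K$-algebra automorphism $\psi$ of $A_1$ with $\psi(z)\in D_{\ge 0}$ or $\psi(z)\in D_{\le 0}$, then $z$ and $w$ generate $A_1$ as a $K$-algebra. (2) In particular, if $z\in D_{\ge 0}$ or $w\in D_{\ge 0}$, then $z$ and $w$ generate $A_1$. (3) If $z\in D_{\le 0}$, then $z=\lambda p+\gamma$ and $w=\lambda^{-1}q+f(p)$ for some $\lambda\in K\setminus\{0\}$, $\gamma\in K$ and $f\in K[X]$. (4) If $z\in D_{\ge 0}$, then $z=\lambda q+\gamma$ and $w=-\lambda^{-1}p+f(q)$ for some $\lambda\in K\setminus\{0\}$, $\gamma\in K$ and $f\in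 K[X]$. -/

import Mathlib

namespace Weyl

/-- The defining relation `p q = q p + 1` between the two free generators
(`true` stands for `p`, `false` stands for `q`). -/
inductive Rel (K : Type*) [Field K] : FreeAlgebra K Bool → FreeAlgebra K Bool → Prop
  | comm : Rel K (FreeAlgebra.ι K true * FreeAlgebra.ι K false)
      (FreeAlgebra.ι K false * FreeAlgebra.ι K true + 1)

/-- The first Weyl algebra over `K`: the associative unital `K`-algebra generated by `p`, `q`
subject to the single relation `p q - q p = 1`. -/
abbrev A1 (K : Type*) [Field K] : Type _ := RingQuot (Rel K)

/-- The generator `p`. -/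
noncomputable def p (K : Type*) [Field K] : A1 K :=
  RingQuot.mkAlgHom K (Rel K) (FreeAlgebra.ι K true)

/-- The generator `q`. -/
noncomputable def q (K : Type*) [Field K] : A1 K :=
  RingQuot.mkAlgHom K (Rel K) (FreeAlgebra.ι K false)

theorem p_mul_q_sub (K : Type*) [Field K] : p K * q K - q K * p K = 1 := by
  have h := RingQuot.mkAlgHom_rel K (Rel.comm (K := K))
  simp only [map_mul, map_add, map_one] at h
  rw [p, q, h, add_sub_cancel_left]

/-- The inner derivation `ad u : v ↦ u v - v u`, as a `K`-linear map. -/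
noncomputable def ad (K : Type*) [Field K] (u : A1 K) : Module.End K (A1 K) :=
  LinearMap.mulLeft K u - LinearMap.mulRight K u

theorem ad_apply (K : Type*) [Field K] (u v : A1 K) : ad K u v = u * v - v * u := rfl

/-- `D K i` is the eigenspace of `ad (p q)` for the eigenvalue `i`. -/
noncomputable def D (K : Type*) [Field K] (i : ℤ) : Submodule K (A1 K) :=
  Module.End.eigenspace (ad K (p K * q K)) (i : K)

/-- The sum of all `D K i` with `i ≥ 0`. -/
noncomputable def DNonneg (K : Type*) [Field K] : Submodule K (A1 K) :=
  ⨆ (i : ℤ) (_ : 0 ≤ i), D K i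

/-- The sum of all `D K i` with `i ≤ 0`. -/
noncomputable def DNonpos (K : Type*) [Field K] : Submodule K (A1 K) :=
  ⨆ (i : ℤ) (_ : i ≤ 0), D K i

/-- `z` is conjugate to `z'` under the group of `K`-algebra automorphisms. -/
def Conj (K : Type*) [Field K] (z z' : A1 K) : Prop :=
  ∃ ψ : A1 K ≃ₐ[K] A1 K, ψ z = z'

/-- `z` and `w` generate the Weyl algebra as a (unital) `K`-algebra. -/
def Generate (K : Type*) [Field K] (z w : A1 K) : Prop :=
  Algebra.adjoin K {z, w} = ⊤

end Weyl

namespace Weyl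

open Polynomial

section Bracket

variable {K : Type*} [Field K]

theorem coeff_taylor_of_natDegree_le_succ {b : K[X]} {e : ℕ} (hb : b.natDegree ≤ e + 1) (r : K) :
    (taylor r b).coeff e = b.coeff e + r * ((e + 1 : ℕ) : K) * b.coeff (e + 1) := by
  have h1 : (hasseDeriv e b).natDegree ≤ 1 := (natDegree_hasseDeriv_le b e).trans (by omega)
  rw [taylor_coeff, eval_eq_sum_range' (Nat.lt_succ_of_le h1), Finset.sum_range_succ,
    Finset.sum_range_one, hasseDeriv_coeff, hasseDeriv_coeff]
  have h2 : (1 + e).choose e = e + 1 := by rw [add_comm, Nat.choose_succ_self_right]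
  rw [h2]
  simp [add_comm 1 e]
  ring

theorem natDegree_taylor_sub_le {b : K[X]} {e : ℕ} (hb : b.natDegree ≤ e + 1) (r : K) :
    (taylor r b - b).natDegree ≤ e := by
  rw [natDegree_le_iff_coeff_eq_zero]
  intro n hn
  obtain ⟨k, rfl⟩ : ∃ k, n = k + 1 := ⟨n - 1, by omega⟩
  rw [coeff_sub, coeff_taylor_of_natDegree_le_succ (by omega : b.natDegree ≤ (k + 1) + 1),
    coeff_eq_zero_of_natDegree_lt (by omega : b.natDegree < k + 1 + 1)]
  ring

theorem taylor_sub_eq_zero {b : K[X]} (hb : b.natDegree = 0) (r : K) : taylor r b - b = 0 := by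
  rw [eq_C_of_natDegree_eq_zero hb, taylor_C, sub_self]

theorem coeff_mul_taylor_sub {a b : K[X]} {d e m : ℕ} (ha : a.natDegree ≤ d)
    (hb : b.natDegree ≤ e) (hm : d + e = m + 1) (r : K) :
    (a * (taylor r b - b)).coeff m = r * e * (a.coeff d * b.coeff e) := by
  rcases e with _ | e
  · rw [taylor_sub_eq_zero (by omega)]; simp
  · obtain rfl : m = d + e := by omega
    rw [coeff_mul_add_eq_of_natDegree_le ha (natDegree_taylor_sub_le hb r), coeff_sub,
      coeff_taylor_of_natDegree_le_succ hb]
    ring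

/-- The product of `a` in degree `i` and `b` in degree `j`, minus the product in the other order,
in the skew Laurent polynomial ring over `K[X]`. -/
noncomputable def termBracket (i j : ℤ) (a b : K[X]) : K[X] :=
  a * taylor (-(i : K)) b - b * taylor (-(j : K)) a

theorem coeff_termBracket {a b : K[X]} {d e m : ℕ} (i j : ℤ) (ha : a.natDegree ≤ d)
    (hb : b.natDegree ≤ e) (hm : d + e = m + 1) :
    (termBracket i j a b).coeff m = ((j * d - i * e : ℤ) : K) * (a.coeff d * b.coeff e) := by
  have h : termBracket i j a b =
      a * (taylor (-(i : K)) b - b) - b * (taylor (-(j : K)) a - a) := by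
    rw [termBracket]; ring
  rw [h, coeff_sub, coeff_mul_taylor_sub ha hb hm,
    coeff_mul_taylor_sub hb ha (by omega : e + d = m + 1)]
  push_cast
  ring

theorem coeff_termBracket_eq_zero {a b : K[X]} {m : ℕ} (i j : ℤ)
    (h : a.natDegree + b.natDegree < m + 1) : (termBracket i j a b).coeff m = 0 := by
  rw [coeff_termBracket (d := m + 1 - b.natDegree) i j (by omega) le_rfl (by omega),
    coeff_eq_zero_of_natDegree_lt (by omega : a.natDegree < m + 1 - b.natDegree)]
  simp

theorem coeff_termBracket_ne_zero [CharZero K] {a b : K[X]} {i j : ℤ} (ha : a ≠ 0) (hb : b ≠ 0)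
    {m : ℕ} (hm : a.natDegree + b.natDegree = m + 1)
    (hij : j * a.natDegree - i * b.natDegree ≠ 0) : (termBracket i j a b).coeff m ≠ 0 := by
  rw [coeff_termBracket i j le_rfl le_rfl hm]
  exact mul_ne_zero (by exact_mod_cast hij)
    (mul_ne_zero (leadingCoeff_ne_zero.2 ha) (leadingCoeff_ne_zero.2 hb))

@[simp] theorem termBracket_zero_right (i j : ℤ) (a : K[X]) : termBracket i j a 0 = 0 := by
  simp [termBracket]

@[simp] theorem termBracket_zero_left (i j : ℤ) (a : K[X]) : termBracket i j 0 a = 0 := by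
  simp [termBracket]

theorem termBracket_of_natDegree_eq_zero {a : K[X]} (ha : a.natDegree = 0) (j : ℤ) (b : K[X]) :
    termBracket 0 j a b = 0 := by
  rw [eq_C_of_natDegree_eq_zero ha]
  simp [termBracket, mul_comm]

/-- The component of degree `n` of the commutator of two skew Laurent polynomials. -/
noncomputable def skewBracket (f g : ℤ →₀ K[X]) (n : ℤ) : K[X] :=
  ∑ i ∈ f.support, termBracket i (n - i) (f i) (g (n - i))

theorem skewBracket_eq_single {f g : ℤ →₀ K[X]} {n : ℤ} (i : ℤ)
    (h : ∀ k, k ≠ i → f k ≠ 0 → termBracket k (n - k) (f k) (g (n - k)) = 0) :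
    skewBracket f g n = termBracket i (n - i) (f i) (g (n - i)) := by
  rw [skewBracket, Finset.sum_eq_single i]
  · intro k hk hki
    exact h k hki (Finsupp.mem_support_iff.1 hk)
  · intro hi
    rw [Finsupp.notMem_support_iff.1 hi, termBracket_zero_left]

theorem coeff_skewBracket_eq_single {f g : ℤ →₀ K[X]} {n : ℤ} {m : ℕ} (i : ℤ)
    (h : ∀ k, k ≠ i → f k ≠ 0 → (termBracket k (n - k) (f k) (g (n - k))).coeff m = 0) :
    (skewBracket f g n).coeff m = (termBracket i (n - i) (f i) (g (n - i))).coeff m := by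
  rw [skewBracket, finsetSum_coeff, Finset.sum_eq_single i]
  · intro k hk hki
    exact h k hki (Finsupp.mem_support_iff.1 hk)
  · intro hi
    rw [Finsupp.notMem_support_iff.1 hi, termBracket_zero_left, coeff_zero]

theorem exists_min_support {f : ℤ →₀ K[X]} (hf : f ≠ 0) :
    ∃ t, f t ≠ 0 ∧ ∀ k, f k ≠ 0 → t ≤ k := by
  have hs : f.support.Nonempty := Finsupp.support_nonempty_iff.2 hf
  exact ⟨f.support.min' hs, Finsupp.mem_support_iff.1 (Finset.min'_mem _ hs),
    fun k hk => Finset.min'_le _ _ (Finsupp.mem_support_iff.2 hk)⟩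

variable [CharZero K] {f g : ℤ →₀ K[X]}

theorem natDegree_zero_of_skewBracket (hf : ∀ i < 0, f i = 0)
    (hfg : ∀ n, skewBracket f g n = if n = 0 then 1 else 0) : (f 0).natDegree = 0 := by
  by_contra hd
  have hg : g ≠ 0 := by
    rintro rfl
    have := hfg 0
    simp [skewBracket] at this
  obtain ⟨t, ht, htmin⟩ := exists_min_support hg
  have hb : skewBracket f g t = termBracket 0 t (f 0) (g t) := by
    rw [skewBracket_eq_single 0, sub_zero]
    intro k hk hfk
    have hk0 : 0 ≤ k := by
      by_contra hlt
      exact hfk (hf k (not_le.1 hlt))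
    have : g (t - k) = 0 := by
      by_contra hne
      have := htmin _ hne
      omega
    rw [this, termBracket_zero_right]
  rw [hfg] at hb
  by_cases ht0 : t = 0
  · subst ht0
    simp [termBracket, mul_comm] at hb
  · have hf0 : f 0 ≠ 0 := by
      intro h0
      simp [h0] at hd
    obtain ⟨m, hm⟩ : ∃ m, (f 0).natDegree + (g t).natDegree = m + 1 :=
      ⟨(f 0).natDegree + (g t).natDegree - 1, by omega⟩
    have := coeff_termBracket_ne_zero (i := 0) (j := t) hf0 ht hm
      (by simpa using ⟨ht0, hd⟩)
    rw [← hb, if_neg ht0] at this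
    simp at this

theorem lowest_components_of_skewBracket (hf : ∀ i < 0, f i = 0)
    (hg : ∀ j < 0, g j ≠ 0 → -j ≤ (g j).natDegree)
    (hfg : ∀ n, skewBracket f g n = if n = 0 then 1 else 0) :
    f 1 ≠ 0 ∧ (f 1).natDegree = 0 ∧ g (-1) ≠ 0 ∧ (g (-1)).natDegree = 1 ∧
      ∀ j < -1, g j = 0 := by
  have hc := natDegree_zero_of_skewBracket hf hfg
  have hf' : f.erase 0 ≠ 0 := by
    intro h
    have h1 := hfg 0
    rw [skewBracket_eq_single 0, termBracket_of_natDegree_eq_zero hc] at h1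
    · simp at h1
    · intro k hk hfk
      have : f.erase 0 k = 0 := by rw [h]; rfl
      rw [Finsupp.erase_ne hk] at this
      exact absurd this hfk
  have hg0 : g ≠ 0 := by
    rintro rfl
    have := hfg 0
    simp [skewBracket] at this
  obtain ⟨t, ht, htmin⟩ := exists_min_support hg0
  obtain ⟨s, hs, hsmin⟩ := exists_min_support hf'
  have hs0 : s ≠ 0 := by
    rintro rfl
    simp at hs
  rw [Finsupp.erase_ne hs0] at hs
  have hspos : 0 < s := by
    by_contra hlt
    exact hs (hf s (by omega))
  have key : ∀ n, n ≤ s + t →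
      skewBracket f g n = termBracket s (n - s) (f s) (g (n - s)) := by
    intro n hn
    refine skewBracket_eq_single s fun k hk hfk => ?_
    by_cases hk0 : k = 0
    · subst hk0
      exact termBracket_of_natDegree_eq_zero hc _ _
    · have h1 := hsmin k (by rwa [Finsupp.erase_ne hk0])
      have : g (n - k) = 0 := by
        by_contra hne
        have := htmin _ hne
        omega
      rw [this, termBracket_zero_right]
  have hts : t ≤ -s := by
    by_contra hlt
    have h1 := key 0 (by omega)
    have : g (0 - s) = 0 := by
      by_contra hne
      have := htmin _ hne
      omega
    rw [hfg, this, termBracket_zero_right] at h1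
    simp at h1
  have he := hg t (by omega) ht
  obtain ⟨m, hm⟩ : ∃ m, (f s).natDegree + (g t).natDegree = m + 1 :=
    ⟨(f s).natDegree + (g t).natDegree - 1, by omega⟩
  have hne := coeff_termBracket_ne_zero (i := s) (j := t) hs ht hm (by
    have h1 : t * ((f s).natDegree : ℤ) ≤ 0 :=
      mul_nonpos_of_nonpos_of_nonneg (by omega) (by positivity)
    have h2 : 0 < s * ((g t).natDegree : ℤ) := mul_pos hspos (by omega)
    omega)
  have hk := key (s + t) le_rfl
  rw [add_sub_cancel_left, hfg] at hk
  rw [← hk] at hne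
  have hst : s + t = 0 := by
    by_contra h
    simp [h] at hne
  rw [if_pos hst, coeff_one] at hne
  have hm0 : m = 0 := by
    by_contra h
    simp [h] at hne
  obtain rfl : s = 1 := by omega
  obtain rfl : t = -1 := by omega
  refine ⟨hs, by omega, ht, by omega, fun j hj => ?_⟩
  by_contra hne
  have := htmin _ hne
  omega

theorem eq_zero_of_skewBracket (hf : ∀ i < 0, f i = 0)
    (hg : ∀ j < 0, g j ≠ 0 → -j ≤ (g j).natDegree)
    (hfg : ∀ n, skewBracket f g n = if n = 0 then 1 else 0) {i₀ : ℤ} (hi₀ : 2 ≤ i₀) :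
    f i₀ = 0 := by
  by_contra hfi₀
  have hc := natDegree_zero_of_skewBracket hf hfg
  obtain ⟨hf1, hd1, hg1, he1, hglow⟩ := lowest_components_of_skewBracket hf hg hfg
  obtain ⟨r, hr0, hrf, hrg, hr⟩ : ∃ r : ℚ, 0 ≤ r ∧
      (∀ i, 1 ≤ i → f i ≠ 0 → ((f i).natDegree : ℚ) ≤ r * (i - 1)) ∧
      (∀ j, g j ≠ 0 → ((g j).natDegree : ℚ) ≤ 1 + r * (j + 1)) ∧
      ((∃ i, 2 ≤ i ∧ f i ≠ 0 ∧ ((f i).natDegree : ℚ) = r * (i - 1)) ∨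
        ∃ j, 0 ≤ j ∧ g j ≠ 0 ∧ ((g j).natDegree : ℚ) = 1 + r * (j + 1)) := by
    let S₁ := (f.support.filter (2 ≤ ·)).image fun i => ((f i).natDegree : ℚ) / (i - 1)
    let S₂ := (g.support.filter (0 ≤ ·)).image fun j => (((g j).natDegree : ℚ) - 1) / (j + 1)
    have h₀ : ((f i₀).natDegree : ℚ) / (i₀ - 1) ∈ S₁ := by
      refine Finset.mem_image.2 ⟨i₀, ?_, rfl⟩
      simp [hi₀, hfi₀]
    have hne : (S₁ ∪ S₂).Nonempty := ⟨_, Finset.mem_union_left _ h₀⟩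
    have hle := fun x hx => Finset.le_max' (S₁ ∪ S₂) x hx
    have hmem := Finset.max'_mem _ hne
    refine ⟨(S₁ ∪ S₂).max' hne, ?_, ?_, ?_, ?_⟩
    · refine le_trans ?_ (hle _ (Finset.mem_union_left _ h₀))
      have : (2 : ℚ) ≤ i₀ := by exact_mod_cast hi₀
      exact div_nonneg (by positivity) (by linarith)
    · intro i hi hfi
      rcases hi.eq_or_lt with rfl | hlt
      · simp [hd1]
      · have h2 : (2 : ℚ) ≤ i := by exact_mod_cast hlt
        have h3 := hle _ (Finset.mem_union_left _ (Finset.mem_image.2 ⟨i, by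
          simp only [Finset.mem_filter, Finsupp.mem_support_iff]; exact ⟨hfi, hlt⟩, rfl⟩))
        rwa [div_le_iff₀ (by linarith)] at h3
    · intro j hgj
      rcases lt_trichotomy j (-1) with hlt | rfl | hlt
      · exact absurd (hglow j hlt) hgj
      · simp [he1]
      · have hj : 0 ≤ j := by omega
        have h2 : (0 : ℚ) ≤ j := by exact_mod_cast hj
        have h3 := hle _ (Finset.mem_union_right _ (Finset.mem_image.2 ⟨j, by
          simp only [Finset.mem_filter, Finsupp.mem_support_iff]; exact ⟨hgj, hj⟩, rfl⟩))
        rw [div_le_iff₀ (by linarith)] at h3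
        linarith
    · rcases Finset.mem_union.1 hmem with h | h
      · obtain ⟨i, hi, hi'⟩ := Finset.mem_image.1 h
        simp only [Finset.mem_filter, Finsupp.mem_support_iff] at hi
        have h2 : (2 : ℚ) ≤ i := by exact_mod_cast hi.2
        exact Or.inl ⟨i, hi.2, hi.1, by
          rw [← hi', div_mul_cancel₀ _ (by linarith)]⟩
      · obtain ⟨j, hj, hj'⟩ := Finset.mem_image.1 h
        simp only [Finset.mem_filter, Finsupp.mem_support_iff] at hj
        have h2 : (0 : ℚ) ≤ j := by exact_mod_cast hj.2
        exact Or.inr ⟨j, hj.2, hj.1, by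
          rw [← hj', div_mul_cancel₀ _ (by linarith)]; ring⟩
  let T₁ := f.support.filter fun i => 1 ≤ i ∧ ((f i).natDegree : ℚ) = r * (i - 1)
  let T₂ := g.support.filter fun j => ((g j).natDegree : ℚ) = 1 + r * (j + 1)
  have hT₁ : T₁.Nonempty := ⟨1, by simp [T₁, hf1, hd1]⟩
  have hT₂ : T₂.Nonempty := ⟨-1, by simp [T₂, hg1, he1]⟩
  obtain ⟨i, hi, himax⟩ : ∃ i ∈ T₁, ∀ k ∈ T₁, k ≤ i :=
    ⟨T₁.max' hT₁, Finset.max'_mem _ _, fun k hk => Finset.le_max' _ _ hk⟩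
  obtain ⟨j, hj, hjmax⟩ : ∃ j ∈ T₂, ∀ k ∈ T₂, k ≤ j :=
    ⟨T₂.max' hT₂, Finset.max'_mem _ _, fun k hk => Finset.le_max' _ _ hk⟩
  simp only [T₁, T₂, Finset.mem_filter, Finsupp.mem_support_iff] at hi hj himax hjmax
  obtain ⟨hfi, hi1, hdi⟩ := hi
  obtain ⟨hgj, hej⟩ := hj
  have hj1 : -1 ≤ j := hjmax (-1) ⟨hg1, by simp [he1]⟩
  have hn : 0 < i + j := by
    rcases hr with ⟨k, hk2, hk⟩ | ⟨k, hk0, hk⟩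
    · have := himax k ⟨hk.1, by omega, hk.2⟩
      omega
    · have := hjmax k hk
      omega
  have hnQ : (0 : ℚ) < i + j := by exact_mod_cast hn
  have hsum : (((f i).natDegree + (g j).natDegree : ℕ) : ℚ) = 1 + r * (i + j) := by
    push_cast
    rw [hdi, hej]
    ring
  have hrn : 0 ≤ r * (i + j) := mul_nonneg hr0 hnQ.le
  obtain ⟨m, hm⟩ : ∃ m, (f i).natDegree + (g j).natDegree = m + 1 := by
    have : 1 ≤ (f i).natDegree + (g j).natDegree := by
      have h : (1 : ℚ) ≤ (((f i).natDegree + (g j).natDegree : ℕ) : ℚ) := by linarith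
      exact_mod_cast h
    exact ⟨_, (Nat.sub_add_cancel this).symm⟩
  have hb : (skewBracket f g (i + j)).coeff m = (termBracket i j (f i) (g j)).coeff m := by
    rw [coeff_skewBracket_eq_single i, add_sub_cancel_left]
    intro k hki hfk
    rcases lt_trichotomy k 0 with hk | rfl | hk
    · exact absurd (hf k hk) hfk
    · rw [termBracket_of_natDegree_eq_zero hc, coeff_zero]
    · by_cases hgk : g (i + j - k) = 0
      · rw [hgk, termBracket_zero_right, coeff_zero]
      · apply coeff_termBracket_eq_zero
        have h1 := hrf k hk hfk
        have h2 := hrg _ hgk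
        rw [← hm]
        by_contra hlt
        have h3 : (((f i).natDegree + (g j).natDegree : ℕ) : ℚ) ≤
            ((f k).natDegree + (g (i + j - k)).natDegree : ℕ) := by
          exact_mod_cast not_lt.1 hlt
        rw [hsum] at h3
        push_cast at h2 h3
        have h4 := himax k ⟨hfk, hk, by linarith⟩
        have h5 := hjmax (i + j - k) ⟨hgk, by push_cast; linarith⟩
        omega
  refine coeff_termBracket_ne_zero (i := i) (j := j) hfi hgj hm ?_ ?_
  · intro h
    have h' : (j : ℚ) * (f i).natDegree - i * (g j).natDegree = 0 := by exact_mod_cast h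
    rw [hdi, hej] at h'
    have : (1 : ℚ) ≤ i := by exact_mod_cast hi1
    linarith
  · rw [← hb, hfg, if_neg hn.ne', coeff_zero]

end Bracket

section Embedding

variable (K : Type*) [Field K]

/-- The integers act on `K[X]` by translation of the variable. -/
noncomputable instance shiftAction : MulSemiringAction (Multiplicative ℤ) K[X] where
  smul n a := taylor (-(n.toAdd : K)) a
  one_smul a := by
    change taylor (-((0 : ℤ) : K)) a = a
    simp
  mul_smul m n a := by
    change taylor (-((m.toAdd + n.toAdd : ℤ) : K)) a =
      taylor (-(m.toAdd : K)) (taylor (-(n.toAdd : K)) a)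
    rw [taylor_taylor]
    rw [Int.cast_add, neg_add]
  smul_zero n := map_zero _
  smul_add n := map_add _
  smul_one n := taylor_one _
  smul_mul n := taylor_mul _

instance : SMulCommClass (Multiplicative ℤ) K K[X] where
  smul_comm n c a := (taylor (-(n.toAdd : K))).map_smul c a

/-- The skew Laurent polynomial ring over `K[X]`. -/
abbrev SkewLaurent : Type _ := SkewMonoidAlgebra K[X] (Multiplicative ℤ)

variable {K} in
/-- The skew Laurent monomial with coefficient `a` in degree `n`. -/
noncomputable def mono (n : ℤ) (a : K[X]) : SkewLaurent K :=
  SkewMonoidAlgebra.single (Multiplicative.ofAdd n) a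

theorem mono_mul_mono (m n : ℤ) (a b : K[X]) :
    mono m a * mono n b = mono (m + n) (a * taylor (-(m : K)) b) := by
  rw [mono, mono, SkewMonoidAlgebra.single_mul_single]
  rfl

theorem mono_add (n : ℤ) (a b : K[X]) : mono n (a + b) = mono n a + mono n b :=
  SkewMonoidAlgebra.single_add _ _ _

theorem mono_zero_one : mono 0 (1 : K[X]) = 1 := rfl

/-- The embedding of the Weyl algebra into the skew Laurent polynomial ring, sending `p q` to the
variable. -/
noncomputable def toSkewLaurent : A1 K →ₐ[K] SkewLaurent K :=
  RingQuot.liftAlgHom K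
    ⟨FreeAlgebra.lift K fun b => if b then mono (-1) X else mono 1 1, by
      rintro _ _ ⟨⟩
      simp only [map_mul, map_add, map_one, FreeAlgebra.lift_ι_apply, if_true,
        Bool.false_eq_true, if_false, mono_mul_mono]
      rw [← mono_zero_one K, neg_add_cancel, add_neg_cancel, ← mono_add]
      simp⟩

@[simp] theorem toSkewLaurent_p : toSkewLaurent K (p K) = mono (-1) X := by
  simp [toSkewLaurent, p]

@[simp] theorem toSkewLaurent_q : toSkewLaurent K (q K) = mono 1 1 := by
  simp [toSkewLaurent, q]

theorem toSkewLaurent_aeval (a : K[X]) :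
    toSkewLaurent K (aeval (p K * q K) a) = mono 0 a := by
  have h1 : toSkewLaurent K (p K * q K) = mono 0 X := by
    simp [mono_mul_mono]
  induction a using Polynomial.induction_on' with
  | add a b ha hb =>
    rw [map_add, map_add, ha, hb, mono_add]
  | monomial n c =>
    induction n with
    | zero =>
      rw [aeval_monomial, pow_zero, mul_one, AlgHom.commutes]
      rfl
    | succ n ih =>
      have h2 : (monomial (n + 1) c : K[X]) = monomial n c * X := by
        rw [monomial_mul_X]
      rw [h2, map_mul, map_mul, ih, aeval_X, h1, mono_mul_mono]
      simp

theorem toSkewLaurent_q_pow (n : ℕ) : toSkewLaurent K (q K ^ n) = mono n 1 := by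
  induction n with
  | zero => simp [← mono_zero_one]
  | succ n ih => rw [pow_succ, map_mul, ih, toSkewLaurent_q, mono_mul_mono]; simp

theorem toSkewLaurent_p_pow (n : ℕ) :
    toSkewLaurent K (p K ^ n) = mono (-n) (ascPochhammer K n) := by
  induction n with
  | zero => simp [← mono_zero_one]
  | succ n ih =>
    rw [pow_succ, map_mul, ih, toSkewLaurent_p, mono_mul_mono, ascPochhammer_succ_right]
    simp [add_comm]

/-- The homogeneous element `q ^ n` for `n ≥ 0`, and `p ^ (-n)` for `n ≤ 0`. -/
noncomputable def homog (n : ℤ) : A1 K := q K ^ n.toNat * p K ^ (-n).toNat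

theorem toSkewLaurent_homog (n : ℤ) :
    toSkewLaurent K (homog K n) = mono n (ascPochhammer K (-n).toNat) := by
  rw [homog, map_mul, toSkewLaurent_q_pow, toSkewLaurent_p_pow, mono_mul_mono]
  rcases le_total 0 n with hn | hn
  · have h1 : (-n).toNat = 0 := by omega
    rw [h1, Int.toNat_of_nonneg hn]
    simp
  · have h1 : n.toNat = 0 := by omega
    rw [h1, Int.toNat_of_nonneg (by omega : 0 ≤ -n)]
    simp

/-- The sum of the `s_n(p q) q ^ n` for `n ≥ 0` and the `s_n(p q) p ^ (-n)` for `n < 0`. -/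
noncomputable def ofComponents : (ℤ →₀ K[X]) →ₗ[K] A1 K :=
  Finsupp.lsum K fun n =>
    LinearMap.mulRight K (homog K n) ∘ₗ (aeval (p K * q K)).toLinearMap

theorem ofComponents_apply (s : ℤ →₀ K[X]) :
    ofComponents K s = ∑ n ∈ s.support, aeval (p K * q K) (s n) * homog K n := rfl

theorem ofComponents_single (n : ℤ) (a : K[X]) :
    ofComponents K (Finsupp.single n a) = aeval (p K * q K) a * homog K n := by
  simp [ofComponents]

theorem p_mul_q : p K * q K = q K * p K + 1 := by
  rw [← p_mul_q_sub K, add_sub_cancel]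

theorem q_mul_aeval (a : K[X]) :
    q K * aeval (p K * q K) a = aeval (p K * q K) (taylor (-1) a) * q K := by
  have h1 : q K * (p K * q K) = (p K * q K - 1) * q K := by
    rw [p_mul_q, add_sub_cancel_right, mul_assoc, ← p_mul_q]
  induction a using Polynomial.induction_on' with
  | add a b ha hb => simp only [map_add, mul_add, add_mul, ha, hb]
  | monomial n c =>
    induction n with
    | zero => simp [Algebra.commutes]
    | succ n ih =>
      have h2 : (monomial (n + 1) c : K[X]) = monomial n c * X := by
        rw [monomial_mul_X]
      rw [h2, map_mul, taylor_mul, map_mul, ← mul_assoc, ih, aeval_X, mul_assoc, h1, taylor_X]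
      simp [mul_assoc, sub_eq_add_neg]

theorem p_mul_aeval (a : K[X]) :
    p K * aeval (p K * q K) a = aeval (p K * q K) (taylor 1 a) * p K := by
  have h1 : p K * (p K * q K) = (p K * q K + 1) * p K := by
    rw [add_mul, mul_assoc, one_mul]
    nth_rw 1 [p_mul_q]
    rw [mul_add, mul_one]
  induction a using Polynomial.induction_on' with
  | add a b ha hb => simp only [map_add, mul_add, add_mul, ha, hb]
  | monomial n c =>
    induction n with
    | zero => simp [Algebra.commutes]
    | succ n ih =>
      have h2 : (monomial (n + 1) c : K[X]) = monomial n c * X := by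
        rw [monomial_mul_X]
      rw [h2, map_mul, taylor_mul, map_mul, ← mul_assoc, ih, aeval_X, mul_assoc, h1, taylor_X]
      simp [mul_assoc]

theorem q_mul_homog (n : ℤ) : ∃ c : K[X],
    q K * homog K n = aeval (p K * q K) c * homog K (n + 1) := by
  rcases le_or_gt 0 n with hn | hn
  · refine ⟨1, ?_⟩
    obtain ⟨k, rfl⟩ := Int.eq_ofNat_of_zero_le hn
    have h1 : (-((k : ℤ) + 1)).toNat = 0 := by omega
    have h2 : ((k : ℤ) + 1).toNat = k + 1 := by omega
    simp only [homog, h1, h2]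
    simp [pow_succ']
  · refine ⟨X - 1, ?_⟩
    obtain ⟨k, hk⟩ := Int.eq_ofNat_of_zero_le (by omega : 0 ≤ -n - 1)
    have h1 : n.toNat = 0 := by omega
    have h2 : (n + 1).toNat = 0 := by omega
    have h3 : (-n).toNat = k + 1 := by omega
    have h4 : (-(n + 1)).toNat = k := by omega
    simp only [homog, h1, h2, h3, h4]
    have h5 : p K * q K - 1 = q K * p K := by rw [p_mul_q, add_sub_cancel_right]
    simp [h5, pow_succ', mul_assoc]

theorem p_mul_homog (n : ℤ) : ∃ c : K[X],
    p K * homog K n = aeval (p K * q K) c * homog K (n - 1) := by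
  rcases le_or_gt n 0 with hn | hn
  · refine ⟨1, ?_⟩
    obtain ⟨k, hk⟩ := Int.eq_ofNat_of_zero_le (by omega : 0 ≤ -n)
    have h1 : n.toNat = 0 := by omega
    have h2 : (n - 1).toNat = 0 := by omega
    have h3 : (-n).toNat = k := by omega
    have h4 : (-(n - 1)).toNat = k + 1 := by omega
    simp only [homog, h1, h2, h3, h4]
    simp [pow_succ']
  · refine ⟨X, ?_⟩
    obtain ⟨k, hk⟩ := Int.eq_ofNat_of_zero_le (by omega : 0 ≤ n - 1)
    have h1 : n.toNat = k + 1 := by omega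
    have h2 : (n - 1).toNat = k := by omega
    have h3 : (-n).toNat = 0 := by omega
    have h4 : (-(n - 1)).toNat = 0 := by omega
    simp only [homog, h1, h2, h3, h4]
    simp [pow_succ', mul_assoc]

theorem adjoin_p_q : Algebra.adjoin K {p K, q K} = ⊤ := by
  have h1 := FreeAlgebra.adjoin_range_ι K Bool
  have h2 : (Algebra.adjoin K (Set.range (FreeAlgebra.ι K : Bool → _))).map
      (RingQuot.mkAlgHom K (Rel K)) = ⊤ := by
    rw [h1, Algebra.map_top, AlgHom.range_eq_top]
    exact RingQuot.mkAlgHom_surjective K (Rel K)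
  rw [AlgHom.map_adjoin, ← Set.range_comp] at h2
  rw [← h2]
  congr 1
  ext x
  simp [p, q, or_comm]

theorem ofComponents_surjective : Function.Surjective (ofComponents K) := by
  have hp : ∀ s, p K * ofComponents K s ∈ LinearMap.range (ofComponents K) := by
    intro s
    rw [ofComponents_apply, Finset.mul_sum]
    refine Submodule.sum_mem _ fun n _ => ?_
    obtain ⟨c, hc⟩ := p_mul_homog K n
    refine ⟨Finsupp.single (n - 1) (taylor 1 (s n) * c), ?_⟩
    rw [ofComponents_single, ← mul_assoc, p_mul_aeval, mul_assoc, hc, map_mul, mul_assoc]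
  have hq : ∀ s, q K * ofComponents K s ∈ LinearMap.range (ofComponents K) := by
    intro s
    rw [ofComponents_apply, Finset.mul_sum]
    refine Submodule.sum_mem _ fun n _ => ?_
    obtain ⟨c, hc⟩ := q_mul_homog K n
    refine ⟨Finsupp.single (n + 1) (taylor (-1) (s n) * c), ?_⟩
    rw [ofComponents_single, ← mul_assoc, q_mul_aeval, mul_assoc, hc, map_mul, mul_assoc]
  have key : ∀ u : A1 K, ∀ v ∈ LinearMap.range (ofComponents K),
      u * v ∈ LinearMap.range (ofComponents K) := by
    intro u
    have hu : u ∈ Algebra.adjoin K {p K, q K} := by rw [adjoin_p_q]; trivial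
    induction hu using Algebra.adjoin_induction with
    | mem x hx =>
      rintro _ ⟨s, rfl⟩
      rcases hx with rfl | rfl
      · exact hp s
      · exact hq s
    | algebraMap r =>
      intro v hv
      rw [← Algebra.smul_def]
      exact Submodule.smul_mem _ _ hv
    | add x y _ _ hx hy =>
      intro v hv
      rw [add_mul]
      exact Submodule.add_mem _ (hx v hv) (hy v hv)
    | mul x y _ _ hx hy =>
      intro v hv
      rw [mul_assoc]
      exact hx _ (hy v hv)
  intro u
  have h1 : (1 : A1 K) ∈ LinearMap.range (ofComponents K) :=
    ⟨Finsupp.single 0 1, by simp [ofComponents_single, homog]⟩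
  simpa using key u 1 h1

/-- The components of the image of an element in the skew Laurent polynomial ring. -/
noncomputable def comps : A1 K →ₗ[K] (ℤ →₀ K[X]) :=
  (Finsupp.domLCongr Multiplicative.toAdd).toLinearMap ∘ₗ
    (SkewMonoidAlgebra.coeffLinearEquiv (S := K)).toLinearMap ∘ₗ (toSkewLaurent K).toLinearMap

theorem comps_apply (u : A1 K) (n : ℤ) :
    comps K u n = (toSkewLaurent K u).coeff (Multiplicative.ofAdd n) := rfl

theorem comps_of_toSkewLaurent {u : A1 K} {n : ℤ} {a : K[X]} (h : toSkewLaurent K u = mono n a) :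
    comps K u = Finsupp.single n a := by
  ext1 k
  rw [comps_apply, h, mono, SkewMonoidAlgebra.coeff_single]
  simp [Finsupp.single_apply]

theorem comps_one : comps K 1 = Finsupp.single 0 1 :=
  comps_of_toSkewLaurent K (map_one _)

theorem comps_q : comps K (q K) = Finsupp.single 1 1 :=
  comps_of_toSkewLaurent K (toSkewLaurent_q K)

theorem comps_p_mul_q : comps K (p K * q K) = Finsupp.single 0 X :=
  comps_of_toSkewLaurent K (by simpa using toSkewLaurent_aeval K X)

theorem comps_ofComponents (s : ℤ →₀ K[X]) (n : ℤ) :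
    comps K (ofComponents K s) n = s n * ascPochhammer K (-n).toNat := by
  have h1 : ∀ k, comps K (aeval (p K * q K) (s k) * homog K k) =
      Finsupp.single k (s k * ascPochhammer K (-k).toNat) := by
    intro k
    apply comps_of_toSkewLaurent
    rw [map_mul, toSkewLaurent_aeval, toSkewLaurent_homog, mono_mul_mono]
    simp
  rw [ofComponents_apply, map_sum, Finsupp.finsetSum_apply]
  simp only [h1, Finsupp.single_apply]
  rw [Finset.sum_ite_eq']
  split_ifs with h
  · rfl
  · rw [Finsupp.notMem_support_iff.1 h, zero_mul]

theorem comps_commutator (u v : A1 K) (n : ℤ) :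
    comps K (u * v - v * u) n = skewBracket (comps K u) (comps K v) n := by
  have h1 : comps K (u * v) n =
      ∑ i ∈ (comps K u).support, comps K u i * taylor (-(i : K)) (comps K v (n - i)) := by
    rw [comps_apply, map_mul, SkewMonoidAlgebra.coeff_mul_left, SkewMonoidAlgebra.sum_def',
      ← SkewMonoidAlgebra.support_coeff]
    refine Finset.sum_equiv Multiplicative.toAdd ?_ ?_
    · intro i
      simp only [Finsupp.mem_support_iff]
      rfl
    · intro i _
      rw [comps_apply, comps_apply, sub_eq_neg_add]
      rfl
  have h2 : comps K (v * u) n = ∑ i ∈ (comps K u).support,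
      comps K v (n - i) * taylor (-((n - i : ℤ) : K)) (comps K u i) := by
    rw [comps_apply, map_mul, SkewMonoidAlgebra.coeff_mul_right, SkewMonoidAlgebra.sum_def',
      ← SkewMonoidAlgebra.support_coeff]
    refine Finset.sum_equiv Multiplicative.toAdd ?_ ?_
    · intro i
      simp only [Finsupp.mem_support_iff]
      rfl
    · intro i _
      rw [comps_apply, comps_apply, sub_eq_add_neg]
      rfl
  rw [map_sub, Finsupp.sub_apply, h1, h2, skewBracket, ← Finset.sum_sub_distrib]
  rfl

theorem natDegree_comps_of_neg (u : A1 K) {n : ℤ} (hn : n < 0) (h : comps K u n ≠ 0) :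
    -n ≤ (comps K u n).natDegree := by
  obtain ⟨s, rfl⟩ := ofComponents_surjective K u
  rw [comps_ofComponents] at h ⊢
  rw [natDegree_mul (left_ne_zero_of_mul h) (right_ne_zero_of_mul h), ascPochhammer_natDegree]
  omega

end Embedding

section Main

variable {K : Type*} [Field K]

theorem commutator_neg_swap {R : Type*} [Ring R] {x y : R} (h : x * y - y * x = 1) :
    y * -x - -x * y = 1 := by
  rw [mul_neg, neg_mul, sub_neg_eq_add, neg_add_eq_sub, h]

theorem eq_add_of_commutator {R : Type*} [Ring R] {x y : R} (h : x * y - y * x = 1) :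
    x * y = y * x + 1 := by
  rw [← h, add_sub_cancel]

theorem mul_eq_one_sub_of_commutator {R : Type*} [Ring R] {x y : R} (h : x * y - y * x = 1) :
    x * y = 1 - y * -x := by
  rw [← h, mul_neg, sub_neg_eq_add, sub_add_cancel]

theorem neg_eq_smul (x : A1 K) : -x = (-1 : K) • x := (neg_one_smul K x).symm

/-- Two elements `x`, `y` with `x y = y x + 1` define a homomorphism from the Weyl algebra. -/
noncomputable def lift {A : Type*} [Semiring A] [Algebra K A] (x y : A) (h : x * y = y * x + 1) :
    A1 K →ₐ[K] A :=
  RingQuot.liftAlgHom K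
    ⟨FreeAlgebra.lift K fun b => if b then x else y, by
      rintro _ _ ⟨⟩
      simpa using h⟩

@[simp] theorem lift_p {A : Type*} [Semiring A] [Algebra K A] (x y : A)
    (h : x * y = y * x + 1) : lift (K := K) x y h (p K) = x := by
  simp [lift, p]

@[simp] theorem lift_q {A : Type*} [Semiring A] [Algebra K A] (x y : A)
    (h : x * y = y * x + 1) : lift (K := K) x y h (q K) = y := by
  simp [lift, q]

theorem algHom_ext {A : Type*} [Semiring A] [Algebra K A] {φ ψ : A1 K →ₐ[K] A}
    (hp : φ (p K) = ψ (p K)) (hq : φ (q K) = ψ (q K)) : φ = ψ := by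
  apply AlgHom.ext_of_adjoin_eq_top (adjoin_p_q K)
  rintro x (rfl | rfl)
  · exact hp
  · exact hq

variable (K) in
/-- The automorphism sending `p` to `q` and `q` to `-p`. -/
noncomputable def fourier : A1 K ≃ₐ[K] A1 K :=
  AlgEquiv.ofAlgHom (lift (q K) (-p K) (eq_add_of_commutator (commutator_neg_swap (p_mul_q_sub K))))
    (lift (-q K) (p K) (eq_add_of_commutator (by
      have := commutator_neg_swap (commutator_neg_swap (commutator_neg_swap (p_mul_q_sub K)))
      rwa [neg_neg] at this)))
    (algHom_ext (by simp) (by simp)) (algHom_ext (by simp) (by simp))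

@[simp] theorem fourier_p : fourier K (p K) = q K := lift_p _ _ _

@[simp] theorem fourier_q : fourier K (q K) = -p K := lift_q _ _ _

@[simp] theorem fourier_symm_p : (fourier K).symm (p K) = -q K := lift_p _ _ _

@[simp] theorem fourier_symm_q : (fourier K).symm (q K) = p K := lift_q _ _ _

theorem mem_D {u : A1 K} {i : ℤ} :
    u ∈ D K i ↔ p K * q K * u - u * (p K * q K) = (i : K) • u := by
  rw [D, Module.End.mem_eigenspace_iff, ad_apply]

theorem fourier_mem_D {u : A1 K} {i : ℤ} (hu : u ∈ D K i) : fourier K u ∈ D K (-i) := by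
  rw [mem_D] at hu ⊢
  have h1 : p K * q K = 1 - fourier K (p K * q K) := by
    rw [map_mul, fourier_p, fourier_q]
    exact mul_eq_one_sub_of_commutator (p_mul_q_sub K)
  have h2 := congrArg (fourier K) hu
  rw [map_sub, map_mul, map_mul _ u, map_smul] at h2
  rw [h1, Int.cast_neg, ← neg_one_mul, mul_smul, ← h2, ← neg_eq_smul, sub_mul, mul_sub]
  simp

theorem fourier_mem_DNonneg {u : A1 K} (hu : u ∈ DNonpos K) : fourier K u ∈ DNonneg K := by
  have h : DNonpos K ≤ (DNonneg K).comap (fourier K).toLinearMap := by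
    refine iSup₂_le fun i hi v hv => ?_
    exact (le_iSup₂_of_le (f := fun (i : ℤ) (_ : 0 ≤ i) => D K i) (-i) (by omega) le_rfl)
      (fourier_mem_D hv)
  exact h hu

theorem generate_of_triangular {x y z w : A1 K} (hxy : Generate K x y) {l m c : K} {f : K[X]}
    (hl : l ≠ 0) (hm : m ≠ 0) (hz : z = l • x + algebraMap K (A1 K) c)
    (hw : w = m • y + aeval x f) : Generate K z w := by
  have hzm : z ∈ Algebra.adjoin K {z, w} := Algebra.subset_adjoin (by simp)
  have hwm : w ∈ Algebra.adjoin K {z, w} := Algebra.subset_adjoin (by simp)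
  have hx : x ∈ Algebra.adjoin K {z, w} := by
    have : x = l⁻¹ • (z - algebraMap K (A1 K) c) := by
      rw [hz, add_sub_cancel_right, inv_smul_smul₀ hl]
    rw [this]
    exact Subalgebra.smul_mem _ (Subalgebra.sub_mem _ hzm (Subalgebra.algebraMap_mem _ _)) _
  have hy : y ∈ Algebra.adjoin K {z, w} := by
    have : y = m⁻¹ • (w - aeval x f) := by
      rw [hw, add_sub_cancel_right, inv_smul_smul₀ hm]
    rw [this]
    exact Subalgebra.smul_mem _ (Subalgebra.sub_mem _ hwm (aeval_mem_adjoin_singleton K x |>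
      Algebra.adjoin_le (Set.singleton_subset_iff.2 hx))) _
  rw [Generate, eq_top_iff, ← hxy]
  apply Algebra.adjoin_le
  rintro _ (rfl | rfl)
  · exact hx
  · exact hy

theorem generate_q_p : Generate K (q K) (p K) := by
  rw [Generate, Set.pair_comm, adjoin_p_q]

theorem generate_p_q : Generate K (p K) (q K) := adjoin_p_q K

theorem Generate.of_algEquiv {z w : A1 K} (ψ : A1 K ≃ₐ[K] A1 K)
    (h : Generate K (ψ z) (ψ w)) : Generate K z w := by
  have h1 : (Algebra.adjoin K {z, w}).map ψ.toAlgHom = ⊤ := by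
    rw [AlgHom.map_adjoin, Set.image_pair]
    exact h
  rw [Generate, eq_top_iff]
  intro x _
  have h2 : ψ x ∈ (Algebra.adjoin K {z, w}).map ψ.toAlgHom := by rw [h1]; trivial
  obtain ⟨y, hy, hyx⟩ := h2
  exact ψ.injective hyx ▸ hy

theorem Generate.of_neg_swap {z w : A1 K} (h : Generate K w (-z)) : Generate K z w := by
  rw [Generate, eq_top_iff, ← h]
  apply Algebra.adjoin_le
  rintro _ (rfl | rfl)
  · exact Algebra.subset_adjoin (by simp)
  · exact Subalgebra.neg_mem _ (Algebra.subset_adjoin (by simp))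

variable [CharZero K]

theorem comps_eq_zero_of_mem_D {u : A1 K} {i n : ℤ} (hu : u ∈ D K i) (hn : n ≠ i) :
    comps K u n = 0 := by
  have h1 := congrArg (fun v => comps K v n) (mem_D.1 hu)
  simp only [comps_commutator, comps_p_mul_q, map_smul, Finsupp.smul_apply] at h1
  rw [skewBracket_eq_single 0] at h1
  · have h2 : ((n - i : ℤ) : K) • comps K u n = 0 := by
      rw [Int.cast_sub, sub_smul, ← h1]
      simp only [termBracket, Finsupp.single_eq_same, sub_zero, Int.cast_zero, neg_zero,
        taylor_zero, taylor_X, smul_eq_C_mul, C_neg]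
      ring
    exact (smul_eq_zero.1 h2).resolve_left (by exact_mod_cast sub_ne_zero.2 hn)
  · intro k hk h
    rw [Finsupp.single_eq_of_ne hk] at h
    exact absurd rfl h

theorem comps_eq_zero_of_mem_DNonneg {u : A1 K} (hu : u ∈ DNonneg K) {n : ℤ} (hn : n < 0) :
    comps K u n = 0 := by
  have h : DNonneg K ≤ LinearMap.ker (Finsupp.lapply n ∘ₗ comps K) :=
    iSup₂_le fun i hi v hv => comps_eq_zero_of_mem_D hv (by omega)
  exact h hu

theorem natDegree_eq_zero_of_taylor_eq {b : K[X]} {r : K} (hr : r ≠ 0) (h : taylor r b = b) :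
    b.natDegree = 0 := by
  by_contra hb
  have h1 := coeff_mul_taylor_sub (a := 1) (b := b) (d := 0) (m := b.natDegree - 1)
    (by simp) le_rfl (by omega) r
  rw [h, sub_self, mul_zero, coeff_zero] at h1
  have hb0 : b ≠ 0 := by
    rintro rfl
    simp at hb
  refine mul_ne_zero (mul_ne_zero hr (Nat.cast_ne_zero.2 hb)) ?_ h1.symm
  simpa using hb0

theorem exists_aeval_q_of_commute {u : A1 K} (hu : q K * u - u * q K = 0) :
    ∃ f : K[X], u = aeval (q K) f := by
  have hconst : ∀ n, (comps K u n).natDegree = 0 := by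
    intro n
    have h1 := comps_commutator K (q K) u (n + 1)
    rw [hu, map_zero, comps_q, skewBracket_eq_single 1] at h1
    · simp only [termBracket, Finsupp.single_eq_same, add_sub_cancel_right, one_mul, taylor_one,
        C_1, mul_one, Finsupp.zero_apply] at h1
      exact natDegree_eq_zero_of_taylor_eq (by simp) (sub_eq_zero.1 h1.symm)
    · intro k hk h
      rw [Finsupp.single_eq_of_ne hk] at h
      exact absurd rfl h
  have hneg : ∀ n < 0, comps K u n = 0 := by
    intro n hn
    by_contra h
    have := natDegree_comps_of_neg K u hn h
    rw [hconst n] at this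
    omega
  obtain ⟨s, rfl⟩ := ofComponents_surjective K u
  suffices h : ofComponents K s ∈ (aeval (R := K) (q K)).range by
    obtain ⟨f, hf⟩ := h
    exact ⟨f, hf.symm⟩
  rw [ofComponents_apply]
  refine Subalgebra.sum_mem _ fun n hn => ?_
  have hsn := Finsupp.mem_support_iff.1 hn
  have hcs := comps_ofComponents K s n
  have hn0 : 0 ≤ n := by
    by_contra hlt
    rw [hneg n (by omega)] at hcs
    exact mul_ne_zero hsn (monic_ascPochhammer K _).ne_zero hcs.symm
  have h0 : (-n).toNat = 0 := by omega
  rw [h0, ascPochhammer_zero, mul_one] at hcs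
  have hc := hconst n
  rw [hcs] at hc
  rw [eq_C_of_natDegree_eq_zero hc, aeval_C, homog, h0, pow_zero, mul_one]
  exact Subalgebra.mul_mem _ (Subalgebra.algebraMap_mem _ _) ⟨X ^ n.toNat, by simp⟩

theorem exists_eq_of_mem_DNonneg {z w : A1 K} (hzw : z * w - w * z = 1) (hz : z ∈ DNonneg K) :
    ∃ (l c : K) (f : K[X]), l ≠ 0 ∧ z = l • q K + algebraMap K (A1 K) c ∧
      w = -(l⁻¹ • p K) + aeval (q K) f := by
  have hf : ∀ i < 0, comps K z i = 0 := fun i hi => comps_eq_zero_of_mem_DNonneg hz hi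
  have hg : ∀ j < 0, comps K w j ≠ 0 → -j ≤ (comps K w j).natDegree :=
    fun j hj => natDegree_comps_of_neg K w hj
  have hfg : ∀ n, skewBracket (comps K z) (comps K w) n = if n = 0 then 1 else 0 := by
    intro n
    rw [← comps_commutator, hzw, comps_one, Finsupp.single_apply]
    simp only [eq_comm]
  have h0 := natDegree_zero_of_skewBracket hf hfg
  obtain ⟨h1, h1', -⟩ := lowest_components_of_skewBracket hf hg hfg
  have h2 : ∀ i, 2 ≤ i → comps K z i = 0 := fun i hi => eq_zero_of_skewBracket hf hg hfg hi
  obtain ⟨l, hl⟩ : ∃ l, comps K z 1 = C l := ⟨_, eq_C_of_natDegree_eq_zero h1'⟩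
  obtain ⟨c, hc⟩ : ∃ c, comps K z 0 = C c := ⟨_, eq_C_of_natDegree_eq_zero h0⟩
  have hl0 : l ≠ 0 := by
    rintro rfl
    exact h1 (by rw [hl, C_0])
  have hz' : z = l • q K + algebraMap K (A1 K) c := by
    obtain ⟨s, rfl⟩ := ofComponents_surjective K z
    have hs : s = Finsupp.single 1 (C l) + Finsupp.single 0 (C c) := by
      ext1 n
      have hcs := comps_ofComponents K s n
      rw [Finsupp.add_apply, Finsupp.single_apply, Finsupp.single_apply]
      rcases lt_trichotomy n 0 with hn | rfl | hn
      · rw [hf n hn, zero_eq_mul] at hcs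
        rw [hcs.resolve_right (monic_ascPochhammer K _).ne_zero]
        rw [if_neg (by omega), if_neg (by omega), add_zero]
      · simpa [hc] using hcs.symm
      · have hn0 : (-n).toNat = 0 := by omega
        rw [hn0, ascPochhammer_zero, mul_one] at hcs
        rw [← hcs]
        by_cases hn1 : n = 1
        · subst hn1
          simpa using hl
        · rw [h2 n (by omega), if_neg (by omega), if_neg (by omega), add_zero]
    rw [hs, map_add, ofComponents_single, ofComponents_single, aeval_C, aeval_C]
    simp [homog, Algebra.smul_def]
  have hqw : q K * w - w * q K = l⁻¹ • 1 := by
    rw [eq_inv_smul_iff₀ hl0, ← hzw, hz', add_mul, mul_add, Algebra.commutes c w]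
    simp [smul_sub]
  obtain ⟨f, hf'⟩ := exists_aeval_q_of_commute (u := w + l⁻¹ • p K) (by
    have : q K * (w + l⁻¹ • p K) - (w + l⁻¹ • p K) * q K =
        (q K * w - w * q K) - l⁻¹ • (p K * q K - q K * p K) := by
      simp only [mul_add, add_mul, mul_smul_comm, smul_mul_assoc, smul_sub]
      abel
    rw [this, hqw, p_mul_q_sub, sub_self])
  refine ⟨l, c, f, hl0, hz', ?_⟩
  rw [← hf']
  abel

theorem exists_eq_of_mem_DNonpos {z w : A1 K} (hzw : z * w - w * z = 1) (hz : z ∈ DNonpos K) :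
    ∃ (l c : K) (f : K[X]), l ≠ 0 ∧ z = l • p K + algebraMap K (A1 K) c ∧
      w = l⁻¹ • q K + aeval (p K) f := by
  have hzw' : fourier K z * fourier K w - fourier K w * fourier K z = 1 := by
    rw [← map_mul, ← map_mul, ← map_sub, hzw, map_one]
  obtain ⟨l, c, f, hl, h1, h2⟩ := exists_eq_of_mem_DNonneg hzw' (fourier_mem_DNonneg hz)
  refine ⟨l, c, f, hl, ?_, ?_⟩
  · rw [← (fourier K).symm_apply_apply z, h1]
    simp
  · rw [← (fourier K).symm_apply_apply w, h2, map_add, ← aeval_algHom_apply]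
    simp

theorem generate_of_mem {z w : A1 K} (hzw : z * w - w * z = 1)
    (hz : z ∈ DNonneg K ∨ z ∈ DNonpos K) : Generate K z w := by
  rcases hz with hz | hz
  · obtain ⟨l, c, f, hl, h1, h2⟩ := exists_eq_of_mem_DNonneg hzw hz
    exact generate_of_triangular generate_q_p hl (neg_ne_zero.2 (inv_ne_zero hl)) h1
      (by rw [h2, neg_eq_smul, smul_smul, neg_one_mul])
  · obtain ⟨l, c, f, hl, h1, h2⟩ := exists_eq_of_mem_DNonpos hzw hz
    exact generate_of_triangular generate_p_q hl (inv_ne_zero hl) h1 h2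

end Main

end Weyl

theorem theorem33 (K : Type*) [Field K] [CharZero K] (z w : Weyl.A1 K)
    (hzw : z * w - w * z = 1) :
    ((∃ z' : Weyl.A1 K, Weyl.Conj K z z' ∧ (z' ∈ Weyl.DNonneg K ∨ z' ∈ Weyl.DNonpos K)) →
      Weyl.Generate K z w) ∧
    ((z ∈ Weyl.DNonneg K ∨ w ∈ Weyl.DNonneg K) → Weyl.Generate K z w) ∧
    (z ∈ Weyl.DNonpos K →
      ∃ (l c : K) (f : Polynomial K), l ≠ 0 ∧
        z = l • Weyl.p K + algebraMap K (Weyl.A1 K) c ∧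
        w = l⁻¹ • Weyl.q K + Polynomial.aeval (Weyl.p K) f) ∧
    (z ∈ Weyl.DNonneg K →
      ∃ (l c : K) (f : Polynomial K), l ≠ 0 ∧
        z = l • Weyl.q K + algebraMap K (Weyl.A1 K) c ∧
        w = -(l⁻¹ • Weyl.p K) + Polynomial.aeval (Weyl.q K) f) := by
  refine ⟨?_, ?_, Weyl.exists_eq_of_mem_DNonpos hzw, Weyl.exists_eq_of_mem_DNonneg hzw⟩
  · rintro ⟨_, ⟨ψ, rfl⟩, h⟩
    refine Weyl.Generate.of_algEquiv ψ (Weyl.generate_of_mem ?_ h)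
    rw [← map_mul, ← map_mul, ← map_sub, hzw, map_one]
  · rintro (h | h)
    · exact Weyl.generate_of_mem hzw (Or.inl h)
    · refine Weyl.Generate.of_neg_swap (Weyl.generate_of_mem ?_ (Or.inl h))
      exact Weyl.commutator_neg_swap hzw
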